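/- **Setting.** There are $N\ge 1$ experts with arbitrary real one-step losses $s^i_t\in\mathbb R$ ($i=1,\dots,N$, $t=1,2,\dots$), fixed in advance (oblivious experts). Put $s^i_{1:T}=\sum_{t=1}^T s^i_t$. For a constant $v_0\ge 0$ let $v_t=v_0+\sum_{j=1}^t\max_i|s^i_j|$ be the volume of the game, $\Delta v_t=v_t-v_{t-1}$, and $\mathrm{fluc}(t)=\Delta v_t/v_t$ (with $0/0=0$). Let $\gamma$ be a non-increasing function of $t=1,2,\dots$ with $0\le\gamma(t)\le 1$, and let $a>0$. The algorithm PROT with parameter $a$ uses the learning rate $$\epsilon_t=\frac{1}{\mu_t v_{t-1}},\qquad \mu_t=\sqrt{\frac{2a(e^{3/a}-1)}{1+\ln N}}\,(\gamma(t))^{1/2}$$ (with $1/\epsilon_t=0$ if $\mu_t v_{t-1}=0$) and i.i.d. random variables $\xi^i_t$ ($i=1,\dots,N$, $t=1,2,\dots$) with density $e^{-x}$ on $x\ge 0$. At step $t$ it follows an expert $$I_t\in\operatorname{argmin}_{i=1,\dots,N}\Big\{s^i_{1:t-1}-\frac{1}{\epsilon_t}\xi^i_t\Big\},$$ ties being broken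 arbitrarily, and suffers the loss $s_t=s^{I_t}_t$; put $s_{1:T}=\sum_{t=1}^T s_t$. **Proposition.** Let $g:\mathbb R\to\mathbb R$ be an even function with $g(0)\ge 0$ and $g(x)>0$ for $x\neq 0$, nondecreasing for $x>0$, such that $x/g(x)$ and $g(x)/x^2$ are non-increasing for $x>0$. Assume that $\mathrm{fluc}(t)\le\gamma(t)$ for all $t\ge 1$, that $\gamma(t)\to 0$ and $v_t\to\infty$ as $t\to\infty$, and that $$\sum_{t=1}^\infty\frac{g(\Delta v_t)}{g(v_t)}<\infty .$$ Then, for every $a>0$, PROT is Hannan consistent in the modified sense, i.e., almost surely $$\limsup_{T\to\infty}\frac{1}{v_T}\Big(s_{1:T}-\min_{i=1,\dots,N}s^i_{1:T}\Big)\le 0 .$$ -/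

import Mathlib

open MeasureTheory ProbabilityTheory Filter Topology

namespace FPL

/- A game with `N` experts is given by its one-step losses: `s t i` is the loss of expert `i` at
step `t`, for `t = 1, 2, …` (the value at `t = 0` is never used). The experts are oblivious: the
losses are fixed real numbers, arbitrary in sign and size. -/

/-- Cumulative loss of expert `i` on the steps `1, …, T`. -/
noncomputable def cumLoss {N : ℕ} (s : ℕ → Fin N → ℝ) (T : ℕ) (i : Fin N) : ℝ :=
  ∑ t ∈ Finset.Icc 1 T, s t i

/-- Largest absolute one-step loss at step `t`. -/
noncomputable def maxAbsLoss {N : ℕ} [NeZero N] (s : ℕ → Fin N → ℝ) (t : ℕ) : ℝ :=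
  Finset.univ.sup' Finset.univ_nonempty (fun i => |s t i|)

/-- Volume of the game, with initial constant `v₀`. -/
noncomputable def volume {N : ℕ} [NeZero N] (v₀ : ℝ) (s : ℕ → Fin N → ℝ) (t : ℕ) : ℝ :=
  v₀ + ∑ j ∈ Finset.Icc 1 t, maxAbsLoss s j

/-- Increment of the volume at step `t ≥ 1`. -/
noncomputable def deltaVolume {N : ℕ} [NeZero N] (v₀ : ℝ) (s : ℕ → Fin N → ℝ) (t : ℕ) : ℝ :=
  volume v₀ s t - volume v₀ s (t - 1)

/-- Scaled fluctuation of the game at step `t ≥ 1` (with `0 / 0 = 0`). -/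
noncomputable def fluc {N : ℕ} [NeZero N] (v₀ : ℝ) (s : ℕ → Fin N → ℝ) (t : ℕ) : ℝ :=
  deltaVolume v₀ s t / volume v₀ s t

/-- The game is non-degenerate if its volume tends to infinity. -/
def NonDegenerate {N : ℕ} [NeZero N] (v₀ : ℝ) (s : ℕ → Fin N → ℝ) : Prop :=
  Tendsto (volume v₀ s) atTop atTop

/-- Smallest cumulative loss of an expert on the steps `1, …, T`. -/
noncomputable def minCumLoss {N : ℕ} [NeZero N] (s : ℕ → Fin N → ℝ) (T : ℕ) : ℝ :=
  Finset.univ.inf' Finset.univ_nonempty (cumLoss s T)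

/-- The exponent `α_t`, as a function of `γ(t)`. -/
noncomputable def alpha (N : ℕ) (a : ℝ) (γ : ℕ → ℝ) (t : ℕ) : ℝ :=
  1 / 2 * (1 - Real.log (a * (1 + Real.log N) / (2 * (Real.exp (3 / a) - 1))) / Real.log (γ t))

/-- The coefficient `μ_t`, in its closed form; this makes sense also when `γ(t) = 1`. See
`mu_eq` for the form `a γ(t)^{α_t}`. -/
noncomputable def mu (N : ℕ) (a : ℝ) (γ : ℕ → ℝ) (t : ℕ) : ℝ :=
  √(2 * a * (Real.exp (3 / a) - 1) / (1 + Real.log N)) * √(γ t)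

/-- The two expressions for `μ_t` agree whenever `α_t` is well defined. -/
theorem mu_eq (N : ℕ) {a : ℝ} (ha : 0 < a) (γ : ℕ → ℝ) (t : ℕ) (h0 : 0 < γ t) (h1 : γ t < 1) :
    mu N a γ t = a * (γ t) ^ alpha N a γ t := by
  have hL : 0 < 1 + Real.log N := by
    have := Real.log_natCast_nonneg N
    linarith
  have hE : 0 < Real.exp (3 / a) - 1 := by
    have := Real.one_lt_exp_iff.mpr (show 0 < 3 / a by positivity)
    linarith
  have hl : Real.log (γ t) ≠ 0 := (Real.log_neg h0 h1).ne
  set B := a * (1 + Real.log N) / (2 * (Real.exp (3 / a) - 1)) with hB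
  have hBpos : 0 < B := by positivity
  have h2 : (γ t) ^ alpha N a γ t = √(γ t) * √(B⁻¹) := by
    rw [Real.rpow_def_of_pos h0, Real.sqrt_eq_rpow, Real.sqrt_eq_rpow, Real.rpow_def_of_pos h0,
      Real.rpow_def_of_pos (inv_pos.mpr hBpos), ← Real.exp_add, Real.log_inv, alpha, ← hB]
    congr 1
    field_simp
    ring
  have h3 : 2 * a * (Real.exp (3 / a) - 1) / (1 + Real.log N) = a ^ 2 * B⁻¹ := by
    rw [hB]
    field_simp
  rw [h2, mu, h3, Real.sqrt_mul (sq_nonneg a), Real.sqrt_sq ha.le]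
  ring

/-- The variable learning rate `ε_t = 1 / (μ_t v_{t-1})`. If `v_{t-1} = 0` the usual
value is `∞`; what is used below is `1 / ε_t`, which is then `0`, here as well. -/
noncomputable def learningRate {N : ℕ} [NeZero N] (a : ℝ) (γ : ℕ → ℝ) (v₀ : ℝ)
    (s : ℕ → Fin N → ℝ) (t : ℕ) : ℝ :=
  1 / (mu N a γ t * volume v₀ s (t - 1))

/-- `ξ t i` (`t = 1, 2, …`, `i` an expert) are i.i.d. random variables, exponentially distributed
with density `exp (-x)` on `x ≥ 0`. -/
structure IsPerturbation {N : ℕ} {Ω : Type*} [MeasurableSpace Ω] (P : Measure Ω)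
    (ξ : ℕ → Fin N → Ω → ℝ) : Prop where
  measurable : ∀ t, 1 ≤ t → ∀ i, Measurable (ξ t i)
  law : ∀ t, 1 ≤ t → ∀ i, P.map (ξ t i) = expMeasure 1
  indep : iIndepFun (fun p : ℕ × Fin N => ξ (p.1 + 1) p.2) P

/-- `I t ω` is the expert chosen at step `t` by the algorithm PROT with parameter `a`: a minimizer
of the perturbed cumulative losses on the steps `< t`. Ties may be broken in any way. -/
def IsPROT {N : ℕ} [NeZero N] {Ω : Type*} (a : ℝ) (γ : ℕ → ℝ) (v₀ : ℝ) (s : ℕ → Fin N → ℝ)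
    (ξ : ℕ → Fin N → Ω → ℝ) (I : ℕ → Ω → Fin N) : Prop :=
  ∀ t, 1 ≤ t → ∀ ω, ∀ i,
    cumLoss s (t - 1) (I t ω) - 1 / learningRate a γ v₀ s t * ξ t (I t ω) ω
      ≤ cumLoss s (t - 1) i - 1 / learningRate a γ v₀ s t * ξ t i ω

/-- Cumulative loss, on the steps `1, …, T`, of the algorithm that chooses expert `I t ω` at
step `t`. -/
noncomputable def algLoss {N : ℕ} {Ω : Type*} (s : ℕ → Fin N → ℝ) (I : ℕ → Ω → Fin N) (T : ℕ)
    (ω : Ω) : ℝ :=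
  ∑ t ∈ Finset.Icc 1 T, s t (I t ω)

/-- Hannan consistency in the modified sense: almost surely, the upper limit of the regret
divided by the volume is at most `0` (upper limit in the extended reals). -/
def HannanConsistent {N : ℕ} [NeZero N] {Ω : Type*} [MeasurableSpace Ω] (P : Measure Ω) (v₀ : ℝ)
    (s : ℕ → Fin N → ℝ) (I : ℕ → Ω → Fin N) : Prop :=
  ∀ᵐ ω ∂P, limsup (fun T : ℕ =>
    ((1 / volume v₀ s T * (algLoss s I T ω - minCumLoss s T) : ℝ) : EReal)) atTop ≤ 0

end FPL

namespace FPL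

/-! The regret splits into an expected part and a fluctuation, each `o(v_T)`.

Expectation. The losses are oblivious, so each expected loss depends only on the law of one
exponential vector. Changing the cumulative losses by at most `D` changes the law of the leader at
scale `η` by a factor at most `exp (2 * D / η)` (`measure_leaderSet_le`). Hence the leader does
almost as well in expectation as one who already sees the current loss, at a cost of `4 * D / η * D`
(`integral_leaderLoss_sub_le`). The losses of that clairvoyant leader telescope, up to the growth of
the scale (`integral_leaderLoss_le`). As `D` is of order `γ v` and `η` of order `√γ v`, both errors
are null sequences times increments of the volume, and a weighted Cesàro argument makes their sums
`o(v_T)`.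

Fluctuation. Fresh perturbations make the realized losses independent, and they are bounded by a
multiple of `Δv_t`. Since `g x / x ^ 2` is non-increasing, `(Δv_t / v_t) ^ 2 ≤ g (Δv_t) / g (v_t)`,
so the normalized variances are summable. Martingale convergence and Kronecker's lemma then give the
strong law. -/

/-! ### Weighted averages along a divergent monotone sequence -/

/-- **Kronecker's lemma.** -/
theorem kronecker_lemma {v y : ℕ → ℝ} {l : ℝ} (hv : Monotone v) (hv_lim : Tendsto v atTop atTop)
    (hy : Tendsto (fun n => ∑ k ∈ Finset.range (n + 1), y k) atTop (𝓝 l)) :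
    Tendsto (fun n => (∑ k ∈ Finset.range (n + 1), v k * y k) / v n) atTop (𝓝 0) := by
  -- Summation by parts with partial sums recentred at `l`: apart from the constant `v 0 * l`, every
  -- term carries a null factor.
  have parts : ∀ n, ∑ k ∈ Finset.range (n + 1), v k * y k
      = v n * (∑ k ∈ Finset.range (n + 1), y k - l) + v 0 * l
        - ∑ k ∈ Finset.range n, (v (k + 1) - v k) * (∑ j ∈ Finset.range (k + 1), y j - l) := by
    intro n
    induction n with
    | zero => simp; ring
    | succ n ih =>
      rw [Finset.sum_range_succ, ih, Finset.sum_range_succ y (n + 1),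
        Finset.sum_range_succ (fun k => (v (k + 1) - v k) * _) n]
      ring
  have hsum : ∀ n, ∑ k ∈ Finset.range n, (v (k + 1) - v k) = v n - v 0 :=
    fun n => Finset.sum_range_sub v n
  have h0 : Tendsto (fun n => ∑ k ∈ Finset.range (n + 1), y k - l) atTop (𝓝 0) := by
    simpa using hy.sub_const l
  have h1 : (fun n => (v (n + 1) - v n) * (∑ j ∈ Finset.range (n + 1), y j - l))
      =o[atTop] fun n => v (n + 1) - v n := by
    simpa using (Asymptotics.isBigO_refl (fun n => v (n + 1) - v n) atTop).mul_isLittleO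
      ((Asymptotics.isLittleO_one_iff ℝ).2 h0)
  -- Little-o passes to partial sums because the increments of `v` are nonnegative with divergent
  -- sum.
  have h2 := h1.sum_range (fun n => sub_nonneg.2 (hv n.le_succ)) (by
    simp only [hsum]
    exact tendsto_atTop_add_const_right _ (-v 0) hv_lim)
  have hconst : ∀ c : ℝ, (fun _ : ℕ => c) =o[atTop] v := fun c =>
    Asymptotics.isLittleO_const_left.2 (Or.inr (tendsto_norm_atTop_atTop.comp hv_lim))
  simp only [hsum] at h2
  have h3 : (fun n => v n - v 0) =O[atTop] v :=
    (Asymptotics.isBigO_refl v atTop).sub (hconst _).isBigO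
  have h4 : (fun n => v n * (∑ k ∈ Finset.range (n + 1), y k - l)) =o[atTop] v := by
    simpa using (Asymptotics.isBigO_refl v atTop).mul_isLittleO
      ((Asymptotics.isLittleO_one_iff ℝ).2 h0)
  have h5 := (h4.add (hconst (v 0 * l))).sub (h2.trans_isBigO h3)
  refine Tendsto.congr (fun n => ?_) h5.tendsto_div_nhds_zero
  rw [parts n]

/-- A weighted Cesàro lemma. -/
theorem tendsto_sum_mul_increment_div {v b : ℕ → ℝ} (hv : Monotone v)
    (hv_lim : Tendsto v atTop atTop) (hb : Tendsto b atTop (𝓝 0)) :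
    Tendsto (fun n => (∑ k ∈ Finset.range n, b k * (v (k + 1) - v k)) / v n) atTop (𝓝 0) := by
  have h1 : (fun n => b n * (v (n + 1) - v n)) =o[atTop] fun n => v (n + 1) - v n := by
    simpa using ((Asymptotics.isLittleO_one_iff ℝ).2 hb).mul_isBigO
      (Asymptotics.isBigO_refl (fun n => v (n + 1) - v n) atTop)
  have h2 := h1.sum_range (fun n => sub_nonneg.2 (hv n.le_succ)) (by
    simp only [Finset.sum_range_sub]
    exact tendsto_atTop_add_const_right _ (-v 0) hv_lim)
  simp only [Finset.sum_range_sub] at h2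
  have hconst : (fun _ : ℕ => v 0) =o[atTop] v :=
    Asymptotics.isLittleO_const_left.2 (Or.inr (tendsto_norm_atTop_atTop.comp hv_lim))
  exact (h2.trans_isBigO ((Asymptotics.isBigO_refl v atTop).sub
    hconst.isBigO)).tendsto_div_nhds_zero

/-! ### Strong law of large numbers by martingale convergence -/

section StrongLaw

variable {Ω : Type*} [MeasurableSpace Ω] {P : Measure Ω} [IsProbabilityMeasure P]

/-- Partial sums of independent centered square integrable random variables with summable
variances converge almost surely. -/
theorem ae_tendsto_sum_of_iIndepFun {X : ℕ → Ω → ℝ} (hX : ∀ n, Measurable (X n))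
    (hL2 : ∀ n, MemLp (X n) 2 P) (hmean : ∀ n, ∫ ω, X n ω ∂P = 0) (hindep : iIndepFun X P)
    (hvar : Summable fun n => ∫ ω, X n ω ^ 2 ∂P) :
    ∀ᵐ ω ∂P, ∃ l, Tendsto (fun n => ∑ k ∈ Finset.range (n + 1), X k ω) atTop (𝓝 l) := by
  have hXs : ∀ n, StronglyMeasurable (X n) := fun n => (hX n).stronglyMeasurable
  set ℱ := Filtration.natural X hXs
  let S : ℕ → Ω → ℝ := fun n ω => ∑ k ∈ Finset.range (n + 1), X k ω
  have hint : ∀ n, Integrable (X n) P := fun n => (hL2 n).integrable (by norm_num)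
  have hSint : ∀ n, Integrable (S n) P := fun n => integrable_finsetSum _ fun k _ => hint k
  have hadp : StronglyAdapted ℱ S := fun n =>
    Finset.stronglyMeasurable_fun_sum _ fun k hk =>
      (Filtration.stronglyAdapted_natural hXs k).mono
        (ℱ.mono (Nat.lt_succ_iff.1 (Finset.mem_range.1 hk)))
  have hmart : Martingale S ℱ P := by
    refine martingale_of_condExp_sub_eq_zero_nat hadp hSint fun n => ?_
    have h : S (n + 1) - S n = X (n + 1) := by
      ext ω
      simp [S, Finset.sum_range_succ _ (n + 1)]
    rw [h]
    refine (iIndepFun.condExp_natural_ae_eq_of_lt hXs hindep n.lt_succ_self).trans ?_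
    filter_upwards with ω
    simp [hmean]
  have hSL2 : ∀ n, MemLp (S n) 2 P := fun n => memLp_finsetSum _ fun k _ => hL2 k
  have hSmean : ∀ n, ∫ ω, S n ω ∂P = 0 := fun n => by
    simp only [S]
    rw [integral_finsetSum _ fun k _ => hint k]
    simp [hmean]
  have hSvar : ∀ n, ∫ ω, S n ω ^ 2 ∂P ≤ ∑' k, ∫ ω, X k ω ^ 2 ∂P := fun n => by
    have h1 := IndepFun.variance_sum (s := Finset.range (n + 1)) (X := X) (μ := P)
      (fun k _ => hL2 k) (fun i _ j _ hij => hindep.indepFun hij)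
    have h2 : ∑ k ∈ Finset.range (n + 1), X k = S n := by ext ω; simp [S]
    rw [h2, variance_of_integral_eq_zero (hSint n).aemeasurable (hSmean n)] at h1
    rw [h1]
    refine le_trans (Finset.sum_le_sum fun k _ => ?_)
      (hvar.sum_le_tsum _ fun k _ => integral_nonneg fun ω => sq_nonneg _)
    exact (variance_of_integral_eq_zero (hX k).aemeasurable (hmean k)).le
  -- The variance bound becomes the `L¹` bound needed for martingale convergence through `|x| ≤ 1 +
  -- x ^ 2`.
  have hbdd : ∀ n, eLpNorm (S n) 1 P ≤ ((1 + ∑' k, ∫ ω, X k ω ^ 2 ∂P).toNNReal : ENNReal) := by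
    intro n
    have h1 : eLpNorm (S n) 1 P = ENNReal.ofReal (∫ ω, ‖S n ω‖ ∂P) := by
      rw [eLpNorm_one_eq_lintegral_enorm, ofReal_integral_norm_eq_lintegral_enorm (hSint n)]
    rw [h1]
    refine ENNReal.ofReal_le_ofReal ?_
    calc ∫ ω, ‖S n ω‖ ∂P ≤ ∫ ω, (1 + S n ω ^ 2) ∂P := by
          refine integral_mono (hSint n).norm ((integrable_const _).add (hSL2 n).integrable_sq) ?_
          intro ω
          simp only [Real.norm_eq_abs]
          nlinarith [sq_nonneg (|S n ω| - 1), sq_abs (S n ω), abs_nonneg (S n ω)]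
      _ = 1 + ∫ ω, S n ω ^ 2 ∂P := by
          rw [integral_add (integrable_const _) (hSL2 n).integrable_sq]
          simp
      _ ≤ _ := by linarith [hSvar n]
  exact hmart.submartingale.exists_ae_tendsto_of_bdd hbdd

/-- A strong law of large numbers for independent bounded random variables. -/
theorem ae_tendsto_sum_div_of_iIndepFun {X : ℕ → Ω → ℝ} {v d : ℕ → ℝ} (hX : ∀ n, Measurable (X n))
    (hbound : ∀ n ω, |X n ω| ≤ d n) (hmean : ∀ n, ∫ ω, X n ω ∂P = 0) (hindep : iIndepFun X P)
    (hv : Monotone v) (hv_lim : Tendsto v atTop atTop) (hv0 : ∀ n, v n = 0 → d n = 0)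
    (hsum : Summable fun n => (d n / v n) ^ 2) :
    ∀ᵐ ω ∂P, Tendsto (fun n => (∑ k ∈ Finset.range (n + 1), X k ω) / v n) atTop (𝓝 0) := by
  have hY : ∀ n, Measurable fun ω => X n ω / v n := fun n => (hX n).div_const _
  have hYb : ∀ n ω, ‖X n ω / v n‖ ≤ |d n / v n| := fun n ω => by
    rw [Real.norm_eq_abs, abs_div, abs_div]
    exact div_le_div_of_nonneg_right ((hbound n ω).trans (le_abs_self _)) (abs_nonneg _)
  have hYL2 : ∀ n, MemLp (fun ω => X n ω / v n) 2 P := fun n =>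
    MemLp.of_bound (hY n).aestronglyMeasurable _ (Eventually.of_forall (hYb n))
  have key := ae_tendsto_sum_of_iIndepFun (P := P) hY hYL2
    (fun n => by rw [integral_div, hmean, zero_div])
    (hindep.comp (fun n x => x / v n) fun n => measurable_id.div_const _) (by
      refine Summable.of_nonneg_of_le (fun n => integral_nonneg fun ω => sq_nonneg _)
        (fun n => ?_) hsum
      calc ∫ ω, (X n ω / v n) ^ 2 ∂P ≤ ∫ _, (d n / v n) ^ 2 ∂P :=
            integral_mono (hYL2 n).integrable_sq (integrable_const _)
              fun ω => sq_le_sq.2 (hYb n ω)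
        _ = _ := by simp)
  filter_upwards [key] with ω hω
  obtain ⟨l, hl⟩ := hω
  refine (kronecker_lemma hv hv_lim hl).congr fun n => ?_
  congr 1
  refine Finset.sum_congr rfl fun k _ => ?_
  -- Division by `v k = 0` loses nothing, since `d k = 0` forces `X k` to vanish there.
  rcases eq_or_ne (v k) 0 with h | h
  · have := hbound k ω
    rw [hv0 k h] at this
    simp [h, abs_nonpos_iff.1 this]
  · field_simp

end StrongLaw

/-! ### The leader under exponential perturbations -/

section Perturbation

theorem measurable_exponentialPDF (r : ℝ) : Measurable (exponentialPDF r) :=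
  (measurable_exponentialPDFReal r).ennreal_ofReal

theorem expMeasure_eq_withDensity (r : ℝ) :
    expMeasure r = MeasureTheory.volume.withDensity (exponentialPDF r) := rfl

/-- A shift by `δ` multiplies the density `exp (-y)` by `exp δ` at most; the rest is translation
invariance of Lebesgue measure. -/
theorem lintegral_add_right_expMeasure_le {f : ℝ → ENNReal} (hf : Measurable f) {δ : ℝ}
    (hδ : 0 ≤ δ) :
    ∫⁻ y, f (y + δ) ∂(expMeasure 1) ≤ ENNReal.ofReal (Real.exp δ) * ∫⁻ y, f y ∂(expMeasure 1) := by
  have hm := measurable_exponentialPDF 1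
  have hpdf : ∀ y, exponentialPDF 1 y
      ≤ ENNReal.ofReal (Real.exp δ) * exponentialPDF 1 (y + δ) := fun y => by
    rcases lt_or_ge y 0 with h | h
    · simp [exponentialPDF_of_neg h]
    · rw [exponentialPDF_of_nonneg h, exponentialPDF_of_nonneg (add_nonneg h hδ),
        ← ENNReal.ofReal_mul (Real.exp_pos _).le, one_mul, one_mul, one_mul, one_mul,
        ← Real.exp_add]
      exact ENNReal.ofReal_le_ofReal (Real.exp_le_exp.2 (by linarith))
  rw [expMeasure_eq_withDensity, lintegral_withDensity_eq_lintegral_mul _ hm hf,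
    lintegral_withDensity_eq_lintegral_mul _ hm (g := fun y => f (y + δ))
      (hf.comp (measurable_add_const δ)),
    ← lintegral_add_right_eq_self (exponentialPDF 1 * f) δ, ← lintegral_const_mul]
  · refine lintegral_mono fun y => ?_
    simp only [Pi.mul_apply, ← mul_assoc]
    exact mul_le_mul_left (hpdf y) _
  · exact (hm.mul hf).comp (measurable_add_const δ)

instance isProbabilityMeasure_expMeasure_one : IsProbabilityMeasure (expMeasure 1) :=
  isProbabilityMeasure_expMeasure one_pos

instance nullSingletonClass_expMeasure : NullSingletonClass (expMeasure 1) :=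
  nullSingletonClass_withDensity _

theorem ae_nonneg_expMeasure : ∀ᵐ x ∂(expMeasure 1), 0 ≤ x := by
  rw [expMeasure_eq_withDensity, ae_withDensity_iff (measurable_exponentialPDF 1)]
  filter_upwards with x hx
  by_contra h
  exact hx (exponentialPDF_of_neg (not_le.1 h))

theorem integrable_id_expMeasure : Integrable (fun x : ℝ => x) (expMeasure 1) := by
  rw [expMeasure_eq_withDensity, integrable_withDensity_iff (measurable_exponentialPDF 1)
    (Eventually.of_forall fun _ => ENNReal.ofReal_lt_top)]
  -- The first moment is the Gamma integral at `2`.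
  have h := (integrable_indicator_iff measurableSet_Ioi).2
    (Real.GammaIntegral_convergent (s := 2) two_pos)
  refine h.congr (Eventually.of_forall fun x => ?_)
  rcases lt_trichotomy x 0 with hx | rfl | hx
  · simp [exponentialPDF_of_neg hx, hx.le]
  · simp
  · have : (2 : ℝ) - 1 = 1 := by norm_num
    simp only [Set.indicator_of_mem (Set.mem_Ioi.2 hx), exponentialPDF_of_nonneg hx.le, one_mul,
      ENNReal.toReal_ofReal (Real.exp_pos _).le, this, Real.rpow_one]
    ring

variable {N : ℕ}

/-- The law of a vector of `N` independent standard exponential random variables. -/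
noncomputable def expVector (N : ℕ) : Measure (Fin N → ℝ) := Measure.pi fun _ => expMeasure 1

instance isProbabilityMeasure_expVector : IsProbabilityMeasure (expVector N) := by
  unfold expVector
  infer_instance

theorem measurePreserving_eval_expVector (i : Fin N) :
    MeasurePreserving (Function.eval i) (expVector N) (expMeasure 1) :=
  measurePreserving_eval _ i

theorem integrable_apply_expVector (i : Fin N) :
    Integrable (fun x : Fin N → ℝ => x i) (expVector N) :=
  (measurePreserving_eval_expVector i).integrable_comp_of_integrable integrable_id_expMeasure

theorem integral_apply_expVector_nonneg (i : Fin N) : 0 ≤ ∫ x, x i ∂(expVector N) :=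
  integral_nonneg_of_ae
    ((measurePreserving_eval_expVector i).quasiMeasurePreserving.ae ae_nonneg_expMeasure)

/-- The perturbations for which expert `i` minimizes the perturbed losses `L j - η * x j`. -/
def leaderSet (L : Fin N → ℝ) (η : ℝ) (i : Fin N) : Set (Fin N → ℝ) :=
  {x | ∀ j, L i - η * x i ≤ L j - η * x j}

theorem measurableSet_leaderSet (L : Fin N → ℝ) (η : ℝ) (i : Fin N) :
    MeasurableSet (leaderSet L η i) := by
  have h : leaderSet L η i = ⋂ j, {x : Fin N → ℝ | L i - η * x i ≤ L j - η * x j} := by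
    ext x
    simp [leaderSet]
  rw [h]
  exact MeasurableSet.iInter fun j => measurableSet_le (by fun_prop) (by fun_prop)

/-- The perturbed losses `L j - η * x j` are pairwise distinct. -/
def NoTies (L : Fin N → ℝ) (η : ℝ) (x : Fin N → ℝ) : Prop :=
  Function.Injective fun i => L i - η * x i

/-- With the other coordinates frozen, a tie between `i` and `j` pins `x i` to a single value, a
null event for an atomless law. -/
theorem ae_noTies (L : Fin N → ℝ) {η : ℝ} (hη : η ≠ 0) : ∀ᵐ x ∂(expVector N), NoTies L η x := by
  have key : ∀ i j : Fin N, i ≠ j →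
      ∀ᵐ x ∂(expVector N), L i - η * x i ≠ L j - η * x j := by
    intro i j hij
    set B : Set (Fin N → ℝ) := {x | L i - η * x i = L j - η * x j}
    have hB : MeasurableSet B := measurableSet_eq_fun (by fun_prop) (by fun_prop)
    have h : ∫⁻ x, B.indicator 1 x ∂(expVector N) ≤ ∫⁻ _, 0 ∂(expVector N) := by
      refine lintegral_le_of_lmarginal_le {i} (measurable_one.indicator hB) measurable_const ?_
      rw [lmarginal_singleton]
      intro x
      refine le_of_eq_of_le ?_ (zero_le)
      refine (lintegral_eq_zero_iff ((measurable_one.indicator hB).comp (measurable_update x))).2 ?_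
      have h1 : ∀ᵐ y ∂(expMeasure 1), y ≠ x j + (L i - L j) / η :=
        compl_mem_ae_iff.2 (measure_singleton _)
      filter_upwards [h1] with y hy
      refine Set.indicator_of_notMem (fun hmem => hy ?_) _
      have h2 : L i - η * y = L j - η * x j := by
        simpa [B, Function.update_of_ne hij.symm] using hmem
      field_simp
      linarith
    rw [lintegral_indicator_one hB, lintegral_zero] at h
    exact measure_eq_zero_iff_ae_notMem.1 (nonpos_iff_eq_zero.1 h)
  have : ∀ᵐ x ∂(expVector N), ∀ i j : Fin N, i ≠ j → L i - η * x i ≠ L j - η * x j := by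
    simp only [ae_all_iff]
    exact key
  filter_upwards [this] with x hx i j hij
  by_contra h
  exact hx i j h hij

/-- Raising `x i` by `2 * D / η` gives expert `i` an extra advantage of `2 * D`, enough to offset a
change of `D` in its own loss and of `D` in a rival's. The factor is the price of that shift. -/
theorem measure_leaderSet_le {L L' : Fin N → ℝ} {η D : ℝ} (hη : 0 < η) (hD : 0 ≤ D)
    (h : ∀ i, |L' i - L i| ≤ D) (i : Fin N) :
    (expVector N).real (leaderSet L η i)
      ≤ Real.exp (2 * D / η) * (expVector N).real (leaderSet L' η i) := by
  set δ := 2 * D / η with hδ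
  have hδ0 : 0 ≤ δ := by positivity
  have hmA := measurableSet_leaderSet L η i
  have hmB := measurableSet_leaderSet L' η i
  have key : ∫⁻ x, (leaderSet L η i).indicator 1 x ∂(expVector N)
      ≤ ∫⁻ x, ENNReal.ofReal (Real.exp δ) * (leaderSet L' η i).indicator 1 x ∂(expVector N) := by
    refine lintegral_le_of_lmarginal_le {i} (measurable_one.indicator hmA)
      ((measurable_one.indicator hmB).const_mul _) ?_
    rw [lmarginal_singleton, lmarginal_singleton]
    intro x
    have hm : Measurable fun y => (leaderSet L' η i).indicator (1 : (Fin N → ℝ) → ENNReal)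
        (Function.update x i y) := (measurable_one.indicator hmB).comp (measurable_update x)
    simp only
    rw [lintegral_const_mul _ hm]
    refine le_trans (lintegral_mono fun y => ?_) (lintegral_add_right_expMeasure_le hm hδ0)
    by_cases hy : Function.update x i y ∈ leaderSet L η i
    · have hy' : Function.update x i (y + δ) ∈ leaderSet L' η i := by
        intro j
        have hηδ : η * δ = 2 * D := by rw [hδ]; field_simp
        rcases eq_or_ne j i with rfl | hj
        · exact le_rfl
        · have h1 := hy j
          simp only [Function.update_self, Function.update_of_ne hj] at h1 ⊢
          have h2 := abs_le.1 (h i)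
          have h3 := abs_le.1 (h j)
          rw [mul_add, hηδ]
          linarith [h2.2, h3.1]
      rw [Set.indicator_of_mem hy, Set.indicator_of_mem hy']
      rfl
    · rw [Set.indicator_of_notMem hy]
      exact zero_le
  rw [lintegral_const_mul _ (measurable_one.indicator hmB), lintegral_indicator_one hmA,
    lintegral_indicator_one hmB] at key
  have := ENNReal.toReal_mono (ENNReal.mul_ne_top ENNReal.ofReal_ne_top (measure_ne_top _ _)) key
  rwa [ENNReal.toReal_mul, ENNReal.toReal_ofReal (Real.exp_pos _).le] at this

/-- The loss of the leader with respect to the perturbed losses `L j - η * x j`. -/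
noncomputable def leaderLoss (L : Fin N → ℝ) (η : ℝ) (s : Fin N → ℝ) (x : Fin N → ℝ) : ℝ :=
  ∑ i, (leaderSet L η i).indicator (fun _ => s i) x

/-- Without ties only one indicator survives, so the sum matches any tie-breaking rule. -/
theorem leaderLoss_eq {L : Fin N → ℝ} {η : ℝ} {x : Fin N → ℝ} (s : Fin N → ℝ)
    (hx : NoTies L η x) {i : Fin N} (hi : x ∈ leaderSet L η i) : leaderLoss L η s x = s i := by
  rw [leaderLoss, Finset.sum_eq_single i, Set.indicator_of_mem hi]
  · intro j _ hj
    refine Set.indicator_of_notMem (fun hmem => hj (hx ?_)) _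
    exact le_antisymm (hmem i) (hi j)
  · simp

theorem measurable_leaderLoss (L : Fin N → ℝ) (η : ℝ) (s : Fin N → ℝ) :
    Measurable (leaderLoss L η s) :=
  Finset.measurable_fun_sum _ fun i _ => measurable_const.indicator (measurableSet_leaderSet L η i)

/-- The factor `N` allows for ties, where several indicators equal `1`. -/
theorem abs_leaderLoss_le (L : Fin N → ℝ) (η : ℝ) {s : Fin N → ℝ} {D : ℝ} (hs : ∀ i, |s i| ≤ D)
    (x : Fin N → ℝ) : |leaderLoss L η s x| ≤ N * D := by
  refine (Finset.abs_sum_le_sum_abs _ _).trans ?_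
  refine (Finset.sum_le_sum fun i _ => (?_ : _ ≤ D)).trans (by simp)
  by_cases h : x ∈ leaderSet L η i
  · simpa [h] using hs i
  · simpa [h] using (abs_nonneg _).trans (hs i)

theorem integrable_leaderLoss (L : Fin N → ℝ) (η : ℝ) (s : Fin N → ℝ) :
    Integrable (leaderLoss L η s) (expVector N) :=
  integrable_finsetSum _ fun i _ =>
    (integrable_const _).indicator (measurableSet_leaderSet L η i)

theorem integral_leaderLoss (L : Fin N → ℝ) (η : ℝ) (s : Fin N → ℝ) :
    ∫ x, leaderLoss L η s x ∂(expVector N)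
      = ∑ i, (expVector N).real (leaderSet L η i) * s i := by
  simp only [leaderLoss]
  rw [integral_finsetSum _ fun i _ =>
    (integrable_const _).indicator (measurableSet_leaderSet L η i)]
  refine Finset.sum_congr rfl fun i _ => ?_
  rw [integral_indicator_const _ (measurableSet_leaderSet L η i), smul_eq_mul]

theorem exists_mem_leaderSet [NeZero N] (L : Fin N → ℝ) (η : ℝ) (x : Fin N → ℝ) :
    ∃ i, x ∈ leaderSet L η i := by
  obtain ⟨i, -, hi⟩ := Finset.exists_min_image Finset.univ (fun i => L i - η * x i)
    Finset.univ_nonempty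
  exact ⟨i, fun j => hi j (Finset.mem_univ j)⟩

theorem sum_measure_leaderSet [NeZero N] (L : Fin N → ℝ) {η : ℝ} (hη : η ≠ 0) :
    ∑ i, (expVector N).real (leaderSet L η i) = 1 := by
  have h := integral_leaderLoss L η (fun _ => 1)
  have h1 : ∫ x, leaderLoss L η (fun _ => 1) x ∂(expVector N) = ∫ _, (1 : ℝ) ∂(expVector N) := by
    refine integral_congr_ae ?_
    filter_upwards [ae_noTies L hη] with x hx
    obtain ⟨i, hi⟩ := exists_mem_leaderSet L η x
    exact leaderLoss_eq _ hx hi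
  rw [h1] at h
  simpa using h.symm

/-- Stability of the expected loss of the perturbed leader. -/
theorem integral_leaderLoss_sub_le [NeZero N] {L L' s : Fin N → ℝ} {η D : ℝ} (hη : 0 < η)
    (hD : 0 ≤ D) (h : ∀ i, |L' i - L i| ≤ D) (hs : ∀ i, |s i| ≤ D) :
    ∫ x, leaderLoss L η s x ∂(expVector N) - ∫ x, leaderLoss L' η s x ∂(expVector N)
      ≤ 4 * D / η * D := by
  rw [integral_leaderLoss, integral_leaderLoss, ← Finset.sum_sub_distrib]
  have hp := sum_measure_leaderSet L hη.ne'
  have hq := sum_measure_leaderSet L' hη.ne'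
  set p := fun i => (expVector N).real (leaderSet L η i) with hp_def
  set q := fun i => (expVector N).real (leaderSet L' η i) with hq_def
  set δ := 2 * D / η with hδ
  have hδ0 : 0 ≤ δ := by positivity
  have hle : ∀ u w : ℝ, 0 ≤ u → u ≤ Real.exp δ * w → u - w ≤ δ * u := by
    intro u w hu huw
    have h1 : Real.exp (-δ) * u ≤ w := by
      have := mul_le_mul_of_nonneg_left huw (Real.exp_pos (-δ)).le
      rwa [← mul_assoc, ← Real.exp_add, neg_add_cancel, Real.exp_zero, one_mul] at this
    have h2 : (1 - δ) * u ≤ Real.exp (-δ) * u :=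
      mul_le_mul_of_nonneg_right (by linarith [Real.add_one_le_exp (-δ)]) hu
    linarith
  -- Losses may have either sign, so `|p i - q i|` is needed and stability is used in both
  -- directions. The weights `p i + q i` have total `2`, whence the constant `4`.
  have hterm : ∀ i, p i * s i - q i * s i ≤ δ * D * (p i + q i) := by
    intro i
    have hp0 : 0 ≤ p i := measureReal_nonneg
    have hq0 : 0 ≤ q i := measureReal_nonneg
    have h1 := hle _ _ hp0 (measure_leaderSet_le hη hD h i)
    have h2 := hle _ _ hq0 (measure_leaderSet_le hη hD (L := L') (L' := L)
      (fun j => by rw [abs_sub_comm]; exact h j) i)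
    have h3 : |p i - q i| ≤ δ * (p i + q i) := by
      rw [abs_le]
      constructor <;> nlinarith [mul_nonneg hδ0 hp0, mul_nonneg hδ0 hq0]
    calc p i * s i - q i * s i = (p i - q i) * s i := by ring
      _ ≤ |p i - q i| * |s i| := (le_abs_self _).trans (abs_mul _ _).le
      _ ≤ (δ * (p i + q i)) * D := mul_le_mul h3 (hs i) (abs_nonneg _) (by positivity)
      _ = _ := by ring
  calc ∑ i, (p i * s i - q i * s i) ≤ ∑ i, δ * D * (p i + q i) :=
        Finset.sum_le_sum fun i _ => hterm i
    _ = 4 * D / η * D := by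
        rw [← Finset.mul_sum, Finset.sum_add_distrib, hp, hq, hδ]
        ring

/-- The smallest perturbed loss. -/
noncomputable def minPerturbed [NeZero N] (L : Fin N → ℝ) (η : ℝ) (x : Fin N → ℝ) : ℝ :=
  Finset.univ.inf' Finset.univ_nonempty fun i => L i - η * x i

theorem minPerturbed_le [NeZero N] (L : Fin N → ℝ) (η : ℝ) (x : Fin N → ℝ) (i : Fin N) :
    minPerturbed L η x ≤ L i - η * x i :=
  Finset.inf'_le _ (Finset.mem_univ i)

theorem minPerturbed_eq [NeZero N] {L : Fin N → ℝ} {η : ℝ} {x : Fin N → ℝ} {i : Fin N}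
    (hi : x ∈ leaderSet L η i) : minPerturbed L η x = L i - η * x i :=
  le_antisymm (minPerturbed_le L η x i) (Finset.le_inf' _ _ fun j _ => hi j)

theorem integrable_minPerturbed [NeZero N] (L : Fin N → ℝ) (η : ℝ) :
    Integrable (minPerturbed L η) (expVector N) := by
  have hm : Continuous (minPerturbed L η) :=
    Continuous.finset_inf'_apply _ fun i _ => by fun_prop
  have hi : ∀ i, Integrable (fun x : Fin N → ℝ => L i - η * x i) (expVector N) := fun i =>
    (integrable_const _).sub ((integrable_apply_expVector i).const_mul η)
  refine (integrable_finsetSum Finset.univ fun i _ => (hi i).norm).mono' hm.measurable.aestronglyMeasurable ?_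
  filter_upwards with x
  obtain ⟨i, hi⟩ := exists_mem_leaderSet L η x
  rw [minPerturbed_eq hi]
  exact Finset.single_le_sum (f := fun i => ‖L i - η * x i‖) (fun _ _ => norm_nonneg _)
    (Finset.mem_univ i)

theorem integral_minPerturbed_le [NeZero N] (L : Fin N → ℝ) {η : ℝ} (hη : 0 ≤ η) (i : Fin N) :
    ∫ x, minPerturbed L η x ∂(expVector N) ≤ L i := by
  calc ∫ x, minPerturbed L η x ∂(expVector N) ≤ ∫ x, (L i - η * x i) ∂(expVector N) :=
        integral_mono (integrable_minPerturbed L η)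
          ((integrable_const _).sub ((integrable_apply_expVector i).const_mul η))
          fun x => minPerturbed_le L η x i
    _ = L i - η * ∫ x, x i ∂(expVector N) := by
        rw [integral_sub (integrable_const _) ((integrable_apply_expVector i).const_mul η),
          integral_const_mul]
        simp
    _ ≤ L i := by linarith [mul_nonneg hη (integral_apply_expVector_nonneg i)]

/-- One step of the "be the leader" inequality with a changing scale of the perturbation. -/
theorem integral_leaderLoss_le [NeZero N] (L s : Fin N → ℝ) {η η' b : ℝ} (hη : η' ≠ 0)
    (hb : η' - η ≤ b) (hb0 : 0 ≤ b) :
    ∫ x, leaderLoss (L + s) η' s x ∂(expVector N)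
      ≤ ∫ x, minPerturbed (L + s) η' x ∂(expVector N) - ∫ x, minPerturbed L η x ∂(expVector N)
        + b * ∫ x, ∑ i, |x i| ∂(expVector N) := by
  have hi : Integrable (fun x : Fin N → ℝ => ∑ i, |x i|) (expVector N) :=
    integrable_finsetSum _ fun i _ => (integrable_apply_expVector i).abs
  have hsub := (integrable_minPerturbed (L + s) η').sub (integrable_minPerturbed L η)
  rw [← integral_sub (integrable_minPerturbed _ _) (integrable_minPerturbed _ _),
    ← integral_const_mul]
  refine le_of_le_of_eq ?_ (integral_add hsub (hi.const_mul b))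
  refine integral_mono_ae (integrable_leaderLoss _ _ _) (hsub.add (hi.const_mul b)) ?_
  filter_upwards [ae_noTies (L + s) hη,
    ae_all_iff.2 fun i => (measurePreserving_eval_expVector i).quasiMeasurePreserving.ae
      ae_nonneg_expMeasure] with x hx hx0
  obtain ⟨i, hi⟩ := exists_mem_leaderSet (L + s) η' x
  rw [leaderLoss_eq s hx hi, minPerturbed_eq hi]
  -- The old minimum is tested at the new leader, which leaves only the change of scale times `x i`.
  have h1 := minPerturbed_le L η x i
  have h2 : |x i| ≤ ∑ i, |x i| :=
    Finset.single_le_sum (f := fun i => |x i|) (fun _ _ => abs_nonneg _) (Finset.mem_univ i)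
  have h3 : (η' - η) * x i ≤ b * ∑ i, |x i| :=
    calc (η' - η) * x i ≤ b * x i := mul_le_mul_of_nonneg_right hb (hx0 i)
      _ ≤ b * ∑ i, |x i| := mul_le_mul_of_nonneg_left ((le_abs_self _).trans h2) hb0
  simp only [Pi.add_apply]
  linarith

end Perturbation

/-! ### Volume and squared fluctuations -/

section Game

variable {N : ℕ} [NeZero N] {v₀ : ℝ} {s : ℕ → Fin N → ℝ}

theorem abs_loss_le_maxAbsLoss (s : ℕ → Fin N → ℝ) (t : ℕ) (i : Fin N) :
    |s t i| ≤ maxAbsLoss s t :=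
  Finset.le_sup' (fun i => |s t i|) (Finset.mem_univ i)

theorem volume_succ (v₀ : ℝ) (s : ℕ → Fin N → ℝ) (n : ℕ) :
    volume v₀ s (n + 1) = volume v₀ s n + maxAbsLoss s (n + 1) := by
  simp only [volume]
  rw [Finset.sum_Icc_succ_top (by omega), add_assoc]

theorem cumLoss_succ {N : ℕ} (s : ℕ → Fin N → ℝ) (n : ℕ) :
    cumLoss s (n + 1) = cumLoss s n + s (n + 1) := by
  ext i
  simp only [cumLoss, Pi.add_apply]
  rw [Finset.sum_Icc_succ_top (by omega)]

theorem deltaVolume_succ (v₀ : ℝ) (s : ℕ → Fin N → ℝ) (n : ℕ) :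
    deltaVolume v₀ s (n + 1) = volume v₀ s (n + 1) - volume v₀ s n := rfl

theorem maxAbsLoss_eq_sub (v₀ : ℝ) (s : ℕ → Fin N → ℝ) (n : ℕ) :
    maxAbsLoss s (n + 1) = volume v₀ s (n + 1) - volume v₀ s n := by
  rw [volume_succ]
  ring

theorem maxAbsLoss_nonneg (s : ℕ → Fin N → ℝ) (t : ℕ) : 0 ≤ maxAbsLoss s t :=
  (abs_nonneg _).trans (abs_loss_le_maxAbsLoss s t 0)

theorem monotone_volume (v₀ : ℝ) (s : ℕ → Fin N → ℝ) : Monotone (volume v₀ s) :=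
  monotone_nat_of_le_succ fun n => by
    rw [volume_succ]
    linarith [maxAbsLoss_nonneg s (n + 1)]

theorem volume_nonneg (hv₀ : 0 ≤ v₀) (n : ℕ) : 0 ≤ volume v₀ s n :=
  add_nonneg hv₀ (Finset.sum_nonneg fun j _ => maxAbsLoss_nonneg s j)

theorem algLoss_eq_sum_range {N : ℕ} {Ω : Type*} (s : ℕ → Fin N → ℝ) (I : ℕ → Ω → Fin N) (T : ℕ) (ω : Ω) :
    algLoss s I T ω = ∑ k ∈ Finset.range T, s (k + 1) (I (k + 1) ω) := by
  induction T with
  | zero => simp [algLoss]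
  | succ n ih =>
    rw [Finset.sum_range_succ, ← ih, algLoss, algLoss, Finset.sum_Icc_succ_top (by omega)]

/-- If `g x / x ^ 2` is non-increasing, then summability of `g (Δ v_t) / g (v_t)` implies
summability of the squared scaled fluctuations. -/
theorem summable_sq_fluc {g : ℝ → ℝ} (hg_zero : 0 ≤ g 0) (hg_pos : ∀ x, 0 < x → 0 < g x)
    (hg_anti : AntitoneOn (fun x => g x / x ^ 2) (Set.Ioi 0)) (hv₀ : 0 ≤ v₀)
    (hsum : Summable fun t : ℕ => g (deltaVolume v₀ s (t + 1)) / g (volume v₀ s (t + 1))) :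
    Summable fun t : ℕ => (maxAbsLoss s (t + 1) / volume v₀ s (t + 1)) ^ 2 := by
  refine hsum.of_nonneg_of_le (fun n => sq_nonneg _) fun n => ?_
  rw [deltaVolume_succ, ← maxAbsLoss_eq_sub]
  have hD := maxAbsLoss_nonneg s (n + 1)
  have hle : maxAbsLoss s (n + 1) ≤ volume v₀ s (n + 1) := by
    rw [volume_succ]
    linarith [volume_nonneg (s := s) hv₀ n]
  set D := maxAbsLoss s (n + 1)
  set w := volume v₀ s (n + 1)
  have hg0 : ∀ x, 0 ≤ x → 0 ≤ g x := fun x hx => by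
    rcases hx.eq_or_lt with rfl | h
    · exact hg_zero
    · exact (hg_pos x h).le
  -- The monotonicity of `g x / x ^ 2` holds only for `x > 0`; a zero increment is trivial because
  -- `0 ≤ g 0`.
  rcases hD.eq_or_lt with h | h
  · rw [← h]
    simpa using div_nonneg hg_zero (hg0 w (hD.trans hle))
  · have hw := h.trans_le hle
    have h1 := hg_anti (Set.mem_Ioi.2 h) (Set.mem_Ioi.2 hw) hle
    simp only at h1
    have h2 := hg_pos w hw
    rw [div_le_div_iff₀ (by positivity) (by positivity)] at h1
    rw [div_pow, div_le_div_iff₀ (by positivity) h2]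
    linarith

end Game

/-! ### Size and growth of the perturbation scale -/

section LearningRate

variable {N : ℕ} [NeZero N] {v₀ : ℝ} {s : ℕ → Fin N → ℝ} {γ : ℕ → ℝ} {a : ℝ}

/-- The scale `1 / ε_{n+1}` of the perturbation used at step `n + 1`. -/
noncomputable def perturbationScale (a : ℝ) (γ : ℕ → ℝ) (v₀ : ℝ) (s : ℕ → Fin N → ℝ) (n : ℕ) : ℝ :=
  mu N a γ (n + 1) * volume v₀ s n

theorem one_div_learningRate (a : ℝ) (γ : ℕ → ℝ) (v₀ : ℝ) (s : ℕ → Fin N → ℝ) (n : ℕ) :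
    1 / learningRate a γ v₀ s (n + 1) = perturbationScale a γ v₀ s n := by
  simp [learningRate, perturbationScale]

/-- Once `γ` vanished it would stay zero, and the volume would stop growing, against its divergence.
-/
theorem gamma_pos (hγ_anti : AntitoneOn γ (Set.Ici 1)) (hγ_mem : ∀ t, 1 ≤ t → 0 ≤ γ t ∧ γ t ≤ 1)
    (hfluc : ∀ t, 1 ≤ t → fluc v₀ s t ≤ γ t) (hv₀ : 0 ≤ v₀) (hnondeg : NonDegenerate v₀ s)
    (n : ℕ) : 0 < γ (n + 1) := by
  refine lt_of_le_of_ne (hγ_mem _ (by omega)).1 fun h => ?_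
  have hconst : ∀ m, n ≤ m → volume v₀ s m ≤ volume v₀ s n := by
    intro m hm
    induction m, hm using Nat.le_induction with
    | base => exact le_rfl
    | succ m hm ih =>
      refine le_trans ?_ ih
      have h1 := hfluc (m + 1) (by omega)
      have h2 := hγ_anti (Set.mem_Ici.2 (by omega : 1 ≤ n + 1))
        (Set.mem_Ici.2 (by omega : 1 ≤ m + 1)) (by omega)
      rw [fluc, deltaVolume_succ] at h1
      rcases (volume_nonneg (s := s) hv₀ (m + 1)).eq_or_lt with h3 | h3
      · rw [← h3]
        exact volume_nonneg hv₀ m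
      · rw [div_le_iff₀ h3] at h1
        have : γ (m + 1) * volume v₀ s (m + 1) ≤ 0 :=
          mul_nonpos_of_nonpos_of_nonneg (by linarith) h3.le
        linarith
  obtain ⟨m, hm1, hm2⟩ := ((hnondeg.eventually_gt_atTop (volume v₀ s n)).and
    (eventually_ge_atTop n)).exists
  exact absurd hm1 (not_lt.2 (hconst m hm2))

theorem mu_coeff_pos (N : ℕ) (ha : 0 < a) :
    0 < √(2 * a * (Real.exp (3 / a) - 1) / (1 + Real.log N)) := by
  have hL : 0 < 1 + Real.log N := by linarith [Real.log_natCast_nonneg N]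
  have hE : 0 < Real.exp (3 / a) - 1 := by
    linarith [Real.one_lt_exp_iff.mpr (show 0 < 3 / a by positivity)]
  positivity

theorem tendsto_mu (N : ℕ) (a : ℝ) (hγ_lim : Tendsto γ atTop (𝓝 0)) :
    Tendsto (mu N a γ) atTop (𝓝 0) := by
  have h := (((Real.continuous_sqrt.tendsto 0).comp hγ_lim).const_mul
    √(2 * a * (Real.exp (3 / a) - 1) / (1 + Real.log N)))
  rw [Real.sqrt_zero, mul_zero] at h
  exact h

theorem mu_nonneg (N : ℕ) (a : ℝ) (γ : ℕ → ℝ) (t : ℕ) : 0 ≤ mu N a γ t := by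
  unfold mu
  positivity

/-- As `mu` is non-increasing, only the growth of the volume can raise the scale. -/
theorem perturbationScale_sub_le (hγ_anti : AntitoneOn γ (Set.Ici 1)) (hv₀ : 0 ≤ v₀) (n : ℕ) :
    perturbationScale a γ v₀ s (n + 1) - perturbationScale a γ v₀ s n
      ≤ mu N a γ (n + 2) * maxAbsLoss s (n + 1) := by
  have h : mu N a γ (n + 2) ≤ mu N a γ (n + 1) :=
    mul_le_mul_of_nonneg_left (Real.sqrt_le_sqrt (hγ_anti (Set.mem_Ici.2 (by omega))
      (Set.mem_Ici.2 (by omega)) (by omega))) (Real.sqrt_nonneg _)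
  have h1 := mul_le_mul_of_nonneg_right h (volume_nonneg (s := s) hv₀ n)
  rw [perturbationScale, perturbationScale, volume_succ, mul_add]
  linarith

/-- The ratio of the one-step losses to the scale of the perturbation tends to `0`. -/
theorem tendsto_div_perturbationScale (hγ_anti : AntitoneOn γ (Set.Ici 1))
    (hγ_mem : ∀ t, 1 ≤ t → 0 ≤ γ t ∧ γ t ≤ 1) (hγ_lim : Tendsto γ atTop (𝓝 0))
    (hfluc : ∀ t, 1 ≤ t → fluc v₀ s t ≤ γ t) (hv₀ : 0 ≤ v₀) (hnondeg : NonDegenerate v₀ s)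
    (ha : 0 < a) :
    Tendsto (fun n => 4 * maxAbsLoss s (n + 1) / perturbationScale a γ v₀ s n) atTop (𝓝 0) := by
  have hc := mu_coeff_pos N ha
  have hγ' : Tendsto (fun n => γ (n + 1)) atTop (𝓝 0) := (tendsto_add_atTop_iff_nat 1).2 hγ_lim
  have hlim : Tendsto (fun n => 8 / √(2 * a * (Real.exp (3 / a) - 1) / (1 + Real.log N))
      * √(γ (n + 1))) atTop (𝓝 0) := by
    simpa using ((Real.continuous_sqrt.tendsto 0).comp hγ').const_mul
      (8 / √(2 * a * (Real.exp (3 / a) - 1) / (1 + Real.log N)))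
  refine squeeze_zero' (Eventually.of_forall fun n => ?_) ?_ hlim
  · exact div_nonneg (by linarith [maxAbsLoss_nonneg s (n + 1)])
      (mul_nonneg (mu_nonneg _ _ _ _) (volume_nonneg hv₀ n))
  filter_upwards [hγ'.eventually (gt_mem_nhds (show (0 : ℝ) < 1 / 2 by norm_num)),
    hnondeg.eventually_gt_atTop 0] with n h1 h2
  have hg := gamma_pos hγ_anti hγ_mem hfluc hv₀ hnondeg n
  have h3 := hfluc (n + 1) (by omega)
  have h4 : 0 < volume v₀ s (n + 1) := h2.trans_le (monotone_volume v₀ s n.le_succ)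
  rw [fluc, deltaVolume_succ, ← maxAbsLoss_eq_sub, div_le_iff₀ h4, volume_succ] at h3
  -- From `D ≤ γ (v + D)` with `γ < 1 / 2`. Against a scale `c √γ v`, the ratio is then at most `8 /
  -- c * √γ`.
  have h5 : maxAbsLoss s (n + 1) ≤ 2 * γ (n + 1) * volume v₀ s n := by
    nlinarith [maxAbsLoss_nonneg s (n + 1)]
  rw [perturbationScale, mu]
  set c := √(2 * a * (Real.exp (3 / a) - 1) / (1 + Real.log N))
  have hsq : √(γ (n + 1)) * √(γ (n + 1)) = γ (n + 1) := Real.mul_self_sqrt hg.le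
  have hs : 0 < √(γ (n + 1)) := Real.sqrt_pos.2 hg
  rw [div_le_iff₀ (by positivity)]
  calc 4 * maxAbsLoss s (n + 1) ≤ 8 * γ (n + 1) * volume v₀ s n := by linarith
    _ = 8 * (√(γ (n + 1)) * √(γ (n + 1))) * volume v₀ s n := by rw [hsq]
    _ = 8 / c * √(γ (n + 1)) * (c * √(γ (n + 1)) * volume v₀ s n) := by field_simp

theorem eventually_perturbationScale_pos (hγ_anti : AntitoneOn γ (Set.Ici 1))
    (hγ_mem : ∀ t, 1 ≤ t → 0 ≤ γ t ∧ γ t ≤ 1) (hfluc : ∀ t, 1 ≤ t → fluc v₀ s t ≤ γ t)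
    (hv₀ : 0 ≤ v₀) (hnondeg : NonDegenerate v₀ s) (ha : 0 < a) :
    ∀ᶠ n in atTop, 0 < perturbationScale a γ v₀ s n := by
  filter_upwards [hnondeg.eventually_gt_atTop 0] with n hn
  exact mul_pos (mul_pos (mu_coeff_pos N ha)
    (Real.sqrt_pos.2 (gamma_pos hγ_anti hγ_mem hfluc hv₀ hnondeg n))) hn

end LearningRate

/-! ### Expected regret -/

section Regret

variable {N : ℕ} [NeZero N]

/-- The expected loss of the algorithm at step `n + 1`. -/
noncomputable def expectedLoss (a : ℝ) (γ : ℕ → ℝ) (v₀ : ℝ) (s : ℕ → Fin N → ℝ) (n : ℕ) : ℝ :=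
  ∫ x, leaderLoss (cumLoss s n) (perturbationScale a γ v₀ s n) (s (n + 1)) x ∂(expVector N)

variable {v₀ : ℝ} {s : ℕ → Fin N → ℝ} {γ : ℕ → ℝ} {a : ℝ}

theorem expectedLoss_succ_le (hγ_anti : AntitoneOn γ (Set.Ici 1)) (hv₀ : 0 ≤ v₀) {n : ℕ}
    (hpos : 0 < perturbationScale a γ v₀ s (n + 1)) :
    expectedLoss a γ v₀ s (n + 1)
      ≤ ∫ x, minPerturbed (cumLoss s (n + 2)) (perturbationScale a γ v₀ s (n + 1)) x ∂(expVector N)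
        - ∫ x, minPerturbed (cumLoss s (n + 1)) (perturbationScale a γ v₀ s n) x ∂(expVector N)
        + mu N a γ (n + 2) * maxAbsLoss s (n + 1) * ∫ x, ∑ i, |x i| ∂(expVector N)
        + 4 * maxAbsLoss s (n + 2) / perturbationScale a γ v₀ s (n + 1) * maxAbsLoss s (n + 2) := by
  have h1 := integral_leaderLoss_le (cumLoss s (n + 1)) (s (n + 2)) hpos.ne'
    (perturbationScale_sub_le hγ_anti hv₀ n)
    (mul_nonneg (mu_nonneg N a γ _) (maxAbsLoss_nonneg s _))
  have h2 := integral_leaderLoss_sub_le (L := cumLoss s (n + 1))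
    (L' := cumLoss s (n + 1) + s (n + 2)) hpos (maxAbsLoss_nonneg s (n + 2))
    (fun i => by simpa using abs_loss_le_maxAbsLoss s (n + 2) i) (abs_loss_le_maxAbsLoss s (n + 2))
  rw [cumLoss_succ s (n + 1)]
  simp only [expectedLoss]
  linarith

/-- The expected regret is `o (v_T)`. -/
theorem exists_expected_regret_le (hγ_anti : AntitoneOn γ (Set.Ici 1))
    (hγ_mem : ∀ t, 1 ≤ t → 0 ≤ γ t ∧ γ t ≤ 1) (hγ_lim : Tendsto γ atTop (𝓝 0))
    (hfluc : ∀ t, 1 ≤ t → fluc v₀ s t ≤ γ t) (hv₀ : 0 ≤ v₀) (hnondeg : NonDegenerate v₀ s)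
    (ha : 0 < a) :
    ∃ r : ℕ → ℝ, Tendsto (fun n => r n / volume v₀ s n) atTop (𝓝 0) ∧
      ∀ᶠ n in atTop, ∑ k ∈ Finset.range n, expectedLoss a γ v₀ s k ≤ minCumLoss s n + r n := by
  obtain ⟨n₀, hn₀⟩ := eventually_atTop.1
    (eventually_perturbationScale_pos (s := s) hγ_anti hγ_mem hfluc hv₀ hnondeg ha)
  set M := ∫ x, ∑ i, |x i| ∂(expVector N)
  let G : ℕ → ℝ := fun n =>
    ∫ x, minPerturbed (cumLoss s (n + 1)) (perturbationScale a γ v₀ s n) x ∂(expVector N)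
  have hb₁ : Tendsto (fun n => mu N a γ (n + 2) * M) atTop (𝓝 0) := by
    simpa using ((tendsto_add_atTop_iff_nat 2).2 (tendsto_mu N a hγ_lim)).mul_const M
  have hb₂ := tendsto_div_perturbationScale hγ_anti hγ_mem hγ_lim hfluc hv₀ hnondeg ha
  set b₁ : ℕ → ℝ := fun n => mu N a γ (n + 2) * M
  set b₂ : ℕ → ℝ := fun n => 4 * maxAbsLoss s (n + 1) / perturbationScale a γ v₀ s n
  set D : ℕ → ℝ := fun n => maxAbsLoss s (n + 1) with hD
  have hM : 0 ≤ M := integral_nonneg fun x => Finset.sum_nonneg fun _ _ => abs_nonneg _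
  have hb₁D : ∀ n, 0 ≤ b₁ n * D n := fun n =>
    mul_nonneg (mul_nonneg (mu_nonneg _ _ _ _) hM) (maxAbsLoss_nonneg s _)
  -- The constant absorbs the initial steps, where the scale may be zero and the one-step bound is
  -- unavailable; from `n₀` on, the terms `G` telescope.
  obtain ⟨C, hC⟩ : ∃ C, ∀ m, n₀ ≤ m → ∑ k ∈ Finset.range (m + 1), expectedLoss a γ v₀ s k
      ≤ C + G m + ∑ k ∈ Finset.range m, b₁ k * D k + ∑ k ∈ Finset.range (m + 1), b₂ k * D k := by
    refine ⟨∑ k ∈ Finset.range (n₀ + 1), expectedLoss a γ v₀ s k - G n₀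
      - ∑ k ∈ Finset.range n₀, b₁ k * D k - ∑ k ∈ Finset.range (n₀ + 1), b₂ k * D k, ?_⟩
    intro m hm
    induction m, hm using Nat.le_induction with
    | base => linarith
    | succ m hm ih =>
      rw [Finset.sum_range_succ _ (m + 1), Finset.sum_range_succ (fun k => b₂ k * D k) (m + 1),
        Finset.sum_range_succ (fun k => b₁ k * D k) m]
      have h : _ ≤ G (m + 1) - G m + _ + b₂ (m + 1) * D (m + 1) :=
        expectedLoss_succ_le hγ_anti hv₀ (hn₀ (m + 1) (by omega))
      have h' : mu N a γ (m + 2) * maxAbsLoss s (m + 1) * M = b₁ m * D m := by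
        simp only [b₁, D]
        ring
      linarith
  refine ⟨fun n => C + ∑ k ∈ Finset.range n, b₁ k * D k + ∑ k ∈ Finset.range n, b₂ k * D k,
    ?_, ?_⟩
  · have h1 := tendsto_sum_mul_increment_div (monotone_volume v₀ s) hnondeg hb₁
    have h2 := tendsto_sum_mul_increment_div (monotone_volume v₀ s) hnondeg hb₂
    have h3 := (tendsto_const_nhds (x := C)).div_atTop hnondeg
    simp only [← maxAbsLoss_eq_sub] at h1 h2
    simpa [add_div] using (h3.add h1).add h2
  · filter_upwards [eventually_ge_atTop (n₀ + 1)] with n hn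
    obtain ⟨m, rfl⟩ : ∃ m, n = m + 1 := ⟨n - 1, by omega⟩
    have h1 := hC m (by omega)
    have h2 : G m ≤ minCumLoss s (m + 1) := Finset.le_inf' _ _ fun i _ =>
      integral_minPerturbed_le _ (hn₀ m (by omega)).le i
    -- The first error sum in `hC` stops one term earlier; the missing term is nonnegative.
    rw [Finset.sum_range_succ (fun k => b₁ k * D k) m]
    linarith [hb₁D m]

end Regret

/-! ### From the random choices to independent losses -/

section Algorithm

variable {N : ℕ} {Ω : Type*} [MeasurableSpace Ω] {P : Measure Ω} {ξ : ℕ → Fin N → Ω → ℝ}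

/-- Grouping the members of an independent family gives independent random vectors. -/
theorem iIndepFun_curry {ι : Type*} {κ : ι → Type*} {𝓧 : (i : ι) → κ i → Type*}
    {m𝓧 : ∀ i j, MeasurableSpace (𝓧 i j)} {X : (i : ι) → (j : κ i) → Ω → 𝓧 i j}
    (mX : ∀ i j, Measurable (X i j))
    (h : iIndepFun (fun (p : (i : ι) × κ i) ω => X p.1 p.2 ω) P) :
    iIndepFun (fun i ω => (X i · ω)) P := by
  have := h.isProbabilityMeasure
  have : ∀ i j, IsProbabilityMeasure (P.map (X i j)) :=
    fun i j => Measure.isProbabilityMeasure_map (mX i j).aemeasurable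
  have hcurry : (MeasurableEquiv.piCurry 𝓧) ∘ (fun ω p => X p.1 p.2 ω) = fun ω i j => X i j ω := by
    ext
    simp [Sigma.curry]
  have hrow : ∀ i, iIndepFun (X i) P := fun i =>
    h.precomp (g := fun j => ⟨i, j⟩) sigma_mk_injective
  rw [iIndepFun_iff_map_fun_eq_infinitePi_map (by fun_prop), ← hcurry,
    ← Measure.map_map (by fun_prop) (by fun_prop),
    (iIndepFun_iff_map_fun_eq_infinitePi_map (by fun_prop)).1 h,
    Measure.infinitePi_map_piCurry (fun i j => P.map (X i j))]
  congrm Measure.infinitePi fun i => ?_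
  rw [(iIndepFun_iff_map_fun_eq_infinitePi_map (by fun_prop)).1 (hrow i)]

theorem IsPerturbation.measurable_vector (hξ : IsPerturbation P ξ) (n : ℕ) :
    Measurable fun ω i => ξ (n + 1) i ω :=
  measurable_pi_lambda _ fun i => hξ.measurable (n + 1) (by omega) i

theorem IsPerturbation.map_vector (hξ : IsPerturbation P ξ) (n : ℕ) :
    P.map (fun ω i => ξ (n + 1) i ω) = expVector N := by
  have h : iIndepFun (fun i : Fin N => ξ (n + 1) i) P :=
    hξ.indep.precomp (g := fun i : Fin N => (n, i)) fun i j hij => (Prod.ext_iff.1 hij).2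
  rw [h.map_fun_eq_pi_map fun i => (hξ.measurable (n + 1) (by omega) i).aemeasurable, expVector]
  congr 1
  ext1 i
  exact hξ.law (n + 1) (by omega) i

theorem IsPerturbation.measurePreserving_vector (hξ : IsPerturbation P ξ) (n : ℕ) :
    MeasurePreserving (fun ω i => ξ (n + 1) i ω) P (expVector N) :=
  ⟨hξ.measurable_vector n, hξ.map_vector n⟩

theorem IsPerturbation.iIndepFun_vector (hξ : IsPerturbation P ξ) :
    iIndepFun (fun n ω i => ξ (n + 1) i ω) P :=
  iIndepFun_curry (X := fun n i => ξ (n + 1) i) (fun n i => hξ.measurable (n + 1) (by omega) i)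
    (hξ.indep.precomp (g := fun p : (_ : ℕ) × Fin N => (p.1, p.2))
      (Equiv.sigmaEquivProd ℕ (Fin N)).injective)

variable [NeZero N]

/-- Almost surely, the realized losses average out to the expected losses. -/
theorem IsPerturbation.ae_tendsto_sum_div [IsProbabilityMeasure P] (hξ : IsPerturbation P ξ) {v₀ : ℝ} (hv₀ : 0 ≤ v₀)
    {s : ℕ → Fin N → ℝ} (hnondeg : NonDegenerate v₀ s)
    (hsum : Summable fun t : ℕ => (maxAbsLoss s (t + 1) / volume v₀ s (t + 1)) ^ 2)
    (a : ℝ) (γ : ℕ → ℝ) :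
    ∀ᵐ ω ∂P, Tendsto (fun n => (∑ k ∈ Finset.range n,
      (leaderLoss (cumLoss s k) (perturbationScale a γ v₀ s k) (s (k + 1)) (fun i => ξ (k + 1) i ω)
        - expectedLoss a γ v₀ s k)) / volume v₀ s n) atTop (𝓝 0) := by
  let f : ℕ → (Fin N → ℝ) → ℝ := fun k x =>
    leaderLoss (cumLoss s k) (perturbationScale a γ v₀ s k) (s (k + 1)) x - expectedLoss a γ v₀ s k
  have hf : ∀ k, Measurable (f k) := fun k => (measurable_leaderLoss _ _ _).sub_const _
  have hloss : ∀ k x, |leaderLoss (cumLoss s k) (perturbationScale a γ v₀ s k) (s (k + 1)) x|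
      ≤ N * maxAbsLoss s (k + 1) := fun k =>
    abs_leaderLoss_le _ _ (abs_loss_le_maxAbsLoss s (k + 1))
  have hexp : ∀ k, |expectedLoss a γ v₀ s k| ≤ N * maxAbsLoss s (k + 1) := fun k => by
    have := norm_integral_le_of_norm_le_const (μ := expVector N)
      (Eventually.of_forall fun x => (Real.norm_eq_abs _).trans_le (hloss k x))
    simpa [expectedLoss] using this
  have hbound : ∀ k ω, |f k fun i => ξ (k + 1) i ω| ≤ 2 * N * maxAbsLoss s (k + 1) := fun k ω => by
    have h1 := abs_sub (leaderLoss (cumLoss s k) (perturbationScale a γ v₀ s k) (s (k + 1))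
      fun i => ξ (k + 1) i ω) (expectedLoss a γ v₀ s k)
    linarith [hloss k fun i => ξ (k + 1) i ω, hexp k]
  have hmean : ∀ k, ∫ ω, f k (fun i => ξ (k + 1) i ω) ∂P = 0 := fun k => by
    have h1 := integral_map (μ := P) (f := f k) (hξ.measurable_vector k).aemeasurable
      (hf k).aestronglyMeasurable
    rw [← h1, hξ.map_vector]
    simp only [f]
    rw [integral_sub (integrable_leaderLoss _ _ _) (integrable_const _)]
    simp [expectedLoss]
  -- The normalizer is the volume after the step, the one for which squared fluctuations are
  -- summable.
  have key := ae_tendsto_sum_div_of_iIndepFun (P := P) (v := fun n => volume v₀ s (n + 1))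
    (fun k => (hf k).comp (hξ.measurable_vector k)) hbound hmean
    (hξ.iIndepFun_vector.comp f hf)
    (fun m n hmn => monotone_volume v₀ s (Nat.succ_le_succ hmn))
    ((tendsto_add_atTop_iff_nat 1).2 hnondeg)
    (fun n hn => by
      rw [volume_succ] at hn
      have := volume_nonneg (s := s) hv₀ n
      have := maxAbsLoss_nonneg s (n + 1)
      have : maxAbsLoss s (n + 1) = 0 := by linarith
      rw [this, mul_zero])
    ((hsum.mul_left ((2 * N : ℝ) ^ 2)).congr fun n => by ring)
  filter_upwards [key] with ω hω
  exact (tendsto_add_atTop_iff_nat 1).1 hω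

/-- Almost surely, whenever the perturbation is nontrivial, the algorithm suffers the loss of the
unique perturbed leader. -/
theorem IsPROT.ae_loss_eq {a v₀ : ℝ} {γ : ℕ → ℝ} {s : ℕ → Fin N → ℝ} {I : ℕ → Ω → Fin N}
    (hI : IsPROT a γ v₀ s ξ I) (hξ : IsPerturbation P ξ) :
    ∀ᵐ ω ∂P, ∀ k, 0 < perturbationScale a γ v₀ s k → s (k + 1) (I (k + 1) ω)
      = leaderLoss (cumLoss s k) (perturbationScale a γ v₀ s k) (s (k + 1))
        (fun i => ξ (k + 1) i ω) := by
  rw [ae_all_iff]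
  intro k
  by_cases hk : 0 < perturbationScale a γ v₀ s k
  · filter_upwards [(hξ.measurePreserving_vector k).quasiMeasurePreserving.ae
      (ae_noTies (cumLoss s k) hk.ne')] with ω hω _
    refine (leaderLoss_eq _ hω fun j => ?_).symm
    have h := hI (k + 1) (by omega) ω j
    rwa [one_div_learningRate, Nat.add_sub_cancel] at h
  · exact Eventually.of_forall fun ω h => absurd h hk

end Algorithm

end FPL

/-! ### Hannan consistency -/

theorem proposition2 {N : ℕ} [NeZero N]
    {Ω : Type*} [MeasurableSpace Ω] (P : Measure Ω) [IsProbabilityMeasure P]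
    -- the function `g`
    (g : ℝ → ℝ) (hg_zero : 0 ≤ g 0) (hg_pos : ∀ x, 0 < x → 0 < g x)
    (hg_even : ∀ x, g (-x) = g x)
    (hg_mono : MonotoneOn g (Set.Ioi 0))
    (hg_anti₁ : AntitoneOn (fun x => x / g x) (Set.Ioi 0))
    (hg_anti₂ : AntitoneOn (fun x => g x / x ^ 2) (Set.Ioi 0))
    -- the game and the bound `γ` of its scaled fluctuation
    (v₀ : ℝ) (hv₀ : 0 ≤ v₀) (s : ℕ → Fin N → ℝ)
    (γ : ℕ → ℝ) (hγ_anti : AntitoneOn γ (Set.Ici 1))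
    (hγ_mem : ∀ t, 1 ≤ t → 0 ≤ γ t ∧ γ t ≤ 1)
    (hγ_lim : Tendsto γ atTop (𝓝 0))
    (hfluc : ∀ t, 1 ≤ t → FPL.fluc v₀ s t ≤ γ t)
    (hnondeg : FPL.NonDegenerate v₀ s)
    (hsum : Summable (fun t : ℕ =>
      g (FPL.deltaVolume v₀ s (t + 1)) / g (FPL.volume v₀ s (t + 1))))
    -- the algorithm PROT with parameter `a`
    (a : ℝ) (ha : 0 < a) (ξ : ℕ → Fin N → Ω → ℝ) (hξ : FPL.IsPerturbation P ξ)
    (I : ℕ → Ω → Fin N) (hI : FPL.IsPROT a γ v₀ s ξ I) :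
    FPL.HannanConsistent P v₀ s I := by
  have hsq := FPL.summable_sq_fluc hg_zero hg_pos hg_anti₂ hv₀ hsum
  obtain ⟨r, hr_lim, hr⟩ :=
    FPL.exists_expected_regret_le hγ_anti hγ_mem hγ_lim hfluc hv₀ hnondeg ha
  obtain ⟨n₀, hn₀⟩ := eventually_atTop.1
    (FPL.eventually_perturbationScale_pos (s := s) hγ_anti hγ_mem hfluc hv₀ hnondeg ha)
  filter_upwards [hξ.ae_tendsto_sum_div hv₀ hnondeg hsq a γ, hI.ae_loss_eq hξ] with ω hω hIω
  let ℓ : ℕ → ℝ := fun k => FPL.leaderLoss (FPL.cumLoss s k) (FPL.perturbationScale a γ v₀ s k)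
    (s (k + 1)) (fun i => ξ (k + 1) i ω)
  -- Before `n₀` the scale may vanish and ties may matter; the discrepancy is constant for a fixed
  -- `ω` and disappears after division by the volume.
  obtain ⟨C, hC⟩ : ∃ C, ∀ n, n₀ ≤ n →
      FPL.algLoss s I n ω = C + ∑ k ∈ Finset.range n, ℓ k := by
    refine ⟨FPL.algLoss s I n₀ ω - ∑ k ∈ Finset.range n₀, ℓ k, fun n hn => ?_⟩
    induction n, hn using Nat.le_induction with
    | base => ring
    | succ n hn ih =>
      have h := hIω n (hn₀ n hn)
      rw [FPL.algLoss_eq_sum_range] at ih ⊢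
      rw [Finset.sum_range_succ, Finset.sum_range_succ ℓ, ih, h]
      ring
  let u : ℕ → ℝ := fun n => C / FPL.volume v₀ s n
    + (∑ k ∈ Finset.range n, (ℓ k - FPL.expectedLoss a γ v₀ s k)) / FPL.volume v₀ s n
    + r n / FPL.volume v₀ s n
  have hu : Tendsto u atTop (𝓝 0) := by
    have h := (((tendsto_const_nhds (x := C)).div_atTop hnondeg).add hω).add hr_lim
    rw [add_zero, add_zero] at h
    exact h
  have hle : ∀ᶠ n in atTop, 1 / FPL.volume v₀ s n
      * (FPL.algLoss s I n ω - FPL.minCumLoss s n) ≤ u n := by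
    filter_upwards [hr, eventually_ge_atTop n₀] with n h1 h2
    have h3 : u n = 1 / FPL.volume v₀ s n
        * (C + ∑ k ∈ Finset.range n, (ℓ k - FPL.expectedLoss a γ v₀ s k) + r n) := by
      simp only [u]
      ring
    rw [h3, hC n h2, Finset.sum_sub_distrib]
    refine mul_le_mul_of_nonneg_left ?_ (one_div_nonneg.2 (FPL.volume_nonneg hv₀ n))
    linarith
  have hlim : Tendsto (fun n => ((u n : ℝ) : EReal)) atTop (𝓝 0) :=
    EReal.tendsto_coe.2 hu
  rw [← hlim.limsup_eq]
  exact limsup_le_limsup (hle.mono fun n hn => EReal.coe_le_coe_iff.2 hn)
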